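/- Let $G$ be a locally compact Hausdorff group, with a Haar measure on $G$ and one on $G\times G$, and let $\mathcal H$ be a complex Hilbert space with unitary group $\mathcal U(\mathcal H)$. Let $U\colon G\to\mathcal U(\mathcal H)$, $g\mapsto U_g$, be a Haar-measurable weak representation, that is: 1. for every $x\in\mathcal H$ and every compact $K\subseteq G$, the map $K\to\mathcal H$, $g\mapsto U_g x$, is almost everywhere equal to a strongly (Bochner) measurable function (if $\mathcal H$ is separable, this is equivalent to Haar measurability on compact sets of all coefficients $g\mapsto\langle y, U_g x\rangle$ with $x,y\in\mathcal H$); 2. $U_gU_h=U_{gh}$ for almost all $(g,h)\in G\times G$ with respect to Haar measure. Then there is a strongly continuous unitary representation of $G$ on $\mathcal H$, that is, a group homomorphism $V\colon G\to\mathcal U(\mathcal H)$ such that $g\mapsto V_gx$ is continuous for every $x\in\mathcal H$, such that $U_g=V_g$ for almost all $g\in G$. -/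

import Mathlib

open MeasureTheory Measure

/-- A Haar measure on the Borel `σ`-algebra of `G × G`. When `G` is not second countable, this
`σ`-algebra may be larger than the product `σ`-algebra, so it is given explicitly. -/
noncomputable def haarPairs (G : Type*) [Group G] [TopologicalSpace G] [IsTopologicalGroup G]
    [LocallyCompactSpace G] : @Measure (G × G) (borel (G × G)) :=
  @Measure.haar (G × G) _ _ _ (borel (G × G))
    (@BorelSpace.mk _ _ (borel (G × G)) rfl) _

/-- A family of unitary operators is Haar measurable if each orbit map `g ↦ U g x` is, over every
compact subset of `G`, almost everywhere equal to a (Bochner) strongly measurable function. On a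
separable Hilbert space this is the measurability over compact sets of all matrix coefficients,
see `isHaarMeasurable_iff_of_separable`. -/
def IsHaarMeasurable {G : Type*} [Group G] [TopologicalSpace G] [IsTopologicalGroup G]
    [LocallyCompactSpace G] [MeasurableSpace G] [BorelSpace G]
    {H : Type*} [NormedAddCommGroup H] [InnerProductSpace ℂ H] [CompleteSpace H]
    (U : G → unitary (H →L[ℂ] H)) : Prop :=
  ∀ (x : H) (K : Set G), IsCompact K →
    AEStronglyMeasurable (fun g => (U g : H →L[ℂ] H) x) ((haar : Measure G).restrict K)

/-- A Haar-measurable weak (unitary) representation of `G` on `H`. -/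
structure IsMeasurableWeakRep {G : Type*} [Group G] [TopologicalSpace G] [IsTopologicalGroup G]
    [LocallyCompactSpace G] [MeasurableSpace G] [BorelSpace G]
    {H : Type*} [NormedAddCommGroup H] [InnerProductSpace ℂ H] [CompleteSpace H]
    (U : G → unitary (H →L[ℂ] H)) : Prop where
  measurable : IsHaarMeasurable U
  mul_ae : ∀ᵐ p ∂(haarPairs G), U p.1 * U p.2 = U (p.1 * p.2)

theorem aestronglyMeasurable_of_coefficients {X : Type*} [MeasurableSpace X] {μ : Measure X}
    {H : Type*} [NormedAddCommGroup H] [InnerProductSpace ℂ H] [CompleteSpace H]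
    [TopologicalSpace.SeparableSpace H] (f : X → H)
    (hf : ∀ y : H, AEMeasurable (fun t => inner ℂ y (f t)) μ) : AEStronglyMeasurable f μ := by
  obtain ⟨w, b, hb⟩ := exists_hilbertBasis ℂ H
  have hw : w.Countable := by
    refine Set.PairwiseDisjoint.countable_of_isOpen (s := fun x : H => Metric.ball x (1 / 2))
      ?_ (fun _ _ => Metric.isOpen_ball) (fun x _ => ⟨x, by simp⟩)
    intro x hx y hy hxy
    refine Metric.ball_disjoint_ball ?_
    have ho : Orthonormal ℂ ((↑) : w → H) := hb ▸ b.orthonormal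
    have h1 : ‖x‖ = 1 := ho.1 ⟨x, hx⟩
    have h2 : ‖y‖ = 1 := ho.1 ⟨y, hy⟩
    have h3 : inner ℂ x y = 0 := ho.2 (i := ⟨x, hx⟩) (j := ⟨y, hy⟩) (by simpa using hxy)
    have h4 := @norm_sub_sq ℂ H _ _ _ x y
    rw [h3, h1, h2] at h4
    simp only [map_zero] at h4
    rw [dist_eq_norm]
    nlinarith [norm_nonneg (x - y)]
  have : Countable w := hw.to_subtype
  refine aestronglyMeasurable_of_tendsto_ae Filter.atTop
    (f := fun (s : Finset w) t => ∑ i ∈ s, b.repr (f t) i • b i) ?_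
    (Filter.Eventually.of_forall fun t => b.hasSum_repr (f t))
  intro s
  refine Finset.aestronglyMeasurable_fun_sum s fun i _ => ?_
  simp only [HilbertBasis.repr_apply_apply]
  exact (hf (b i)).aestronglyMeasurable.smul_const _

/-- On a separable Hilbert space, Haar measurability is measurability of the coefficients. -/
theorem isHaarMeasurable_iff_of_separable {G : Type*} [Group G] [TopologicalSpace G]
    [IsTopologicalGroup G] [LocallyCompactSpace G] [MeasurableSpace G] [BorelSpace G]
    {H : Type*} [NormedAddCommGroup H] [InnerProductSpace ℂ H] [CompleteSpace H]
    [TopologicalSpace.SeparableSpace H] (U : G → unitary (H →L[ℂ] H)) :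
    IsHaarMeasurable U ↔ ∀ (x y : H) (K : Set G), IsCompact K →
      AEMeasurable (fun g => inner ℂ y ((U g : H →L[ℂ] H) x)) ((haar : Measure G).restrict K) :=
  ⟨fun h x _ K hK => (aestronglyMeasurable_const.inner (h x K hK)).aemeasurable,
    fun h x K hK => aestronglyMeasurable_of_coefficients _ fun y => h x y K hK⟩

/-!
The idea is to define `V` by the equation that a representation almost everywhere equal to `U` has
to satisfy. Let `A` be the set of those `h` for which there is a single unitary `W` with
`W * U g = U (h * g)` for almost all `g`. Such a `W` is unique, `A` is a subgroup by left invariance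
of Haar measure, and almost every `h` lies in `A`, with `W = U h`, as soon as the multiplicativity
of `U` on almost all pairs can be read as "for almost all `h`, for almost all `g`". A conull
subgroup is everything, so `V h := W` is a homomorphism, equal to `U` almost everywhere
(`exists_monoidHom_ae_eq`). No measurability of `U` is needed so far.

Measurability of `U` passes to `V`, and a measurable homomorphism into the unitary group is strongly
continuous by the Steinhaus theorem: on some `E` of positive measure the orbit map of `x` varies by
less than `ε`, and `E / E` is a neighbourhood of `1`
(`MonoidHom.continuous_apply_of_isHaarMeasurable`).

What remains is the passage from almost all pairs to iterated quantifiers. Haar measure on `G × G`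
lives on the Borel `σ`-algebra, which may be larger than the product `σ`-algebra, so Fubini's
theorem is not directly available. If `G` is `σ`-compact, then by uniqueness of Haar measure the
Haar measure of `G × G` restricts to a multiple of the product measure; a null set is covered by
open sets of small measure, and an open set with many large sections contains, by the tube lemma, a
large set of the product `σ`-algebra (`ae_ae_notMem_of_measure_eq_zero`). If `G` is not `σ`-compact,
then a null set of pairs has its first coordinates in a `σ`-compact set `D`; translating by some
`g` outside `D` and another `σ`-compact set shows that `U` is multiplicative everywhere
(`forall_mul_eq_of_forall_notMem_isSigmaCompact`).
-/

open scoped Pointwise Topology ENNReal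

/-! ### Homomorphisms from almost everywhere multiplicative maps -/

theorem exists_monoidHom_ae_eq {G R : Type*} [Group G] [MeasurableSpace G] [MeasurableMul G]
    [Group R] {μ : Measure G} [μ.IsMulLeftInvariant] [NeZero μ] {U : G → R}
    (hU : ∀ᵐ h ∂μ, ∀ᵐ g ∂μ, U h * U g = U (h * g)) :
    ∃ V : G →* R, ∀ᵐ g ∂μ, U g = V g := by
  have shift {p : G → Prop} (h : G) (hp : ∀ᵐ g ∂μ, p g) : ∀ᵐ g ∂μ, p (h * g) :=
    (measurePreserving_mul_left μ h).quasiMeasurePreserving.ae hp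
  -- The elements whose left translation acts on `U` as a left multiplication; it is a conull
  -- subgroup, hence everything.
  let A : Subgroup G :=
    { carrier := {h | ∃ W : R, ∀ᵐ g ∂μ, W * U g = U (h * g)}
      one_mem' := ⟨1, by simp⟩
      mul_mem' := by
        rintro a b ⟨W, hW⟩ ⟨W', hW'⟩
        refine ⟨W * W', ?_⟩
        filter_upwards [shift b hW, hW'] with g h1 h2
        rw [mul_assoc, h2, h1, mul_assoc]
      inv_mem' := by
        rintro a ⟨W, hW⟩
        refine ⟨W⁻¹, ?_⟩
        filter_upwards [shift a⁻¹ hW] with g h1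
        rw [mul_inv_cancel_left] at h1
        rw [← h1, inv_mul_cancel_left] }
  have hA : ∀ᵐ h ∂μ, h ∈ A := hU.mono fun h hh => ⟨U h, hh⟩
  have key (h : G) : ∃ W : R, ∀ᵐ g ∂μ, W * U g = U (h * g) := by
    obtain ⟨g, hg, hhg⟩ := (hA.and (shift h hA)).exists
    exact (A.mul_mem_cancel_right hg).1 hhg
  have uniq {h : G} {W W' : R} (h1 : ∀ᵐ g ∂μ, W * U g = U (h * g))
      (h2 : ∀ᵐ g ∂μ, W' * U g = U (h * g)) : W = W' := by
    obtain ⟨g, hg, hg'⟩ := (h1.and h2).exists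
    exact mul_right_cancel (hg.trans hg'.symm)
  choose V hV using key
  refine ⟨MonoidHom.mk' V fun a b => uniq (hV (a * b)) ?_, ?_⟩
  · filter_upwards [shift b (hV a), hV b] with g h1 h2
    rw [mul_assoc, h2, h1, mul_assoc]
  · filter_upwards [hU] with h hh
    exact uniq hh (hV h)

/-! ### Continuity of measurable unitary representations -/

section Steinhaus

variable {G : Type*} [Group G] [TopologicalSpace G] [IsTopologicalGroup G]
  [LocallyCompactSpace G] [T2Space G] [MeasurableSpace G] [BorelSpace G]
  {H : Type*} [NormedAddCommGroup H] [InnerProductSpace ℂ H] [CompleteSpace H]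

theorem norm_unitary_apply (u : unitary (H →L[ℂ] H)) (x : H) : ‖(u : H →L[ℂ] H) x‖ = ‖x‖ :=
  (Unitary.linearIsometryEquiv u).norm_map x

/-- The essential range of `f` is separable, so countably many balls of radius `ε / 2` cover it, and
the preimage of one of them is not null. -/
theorem exists_measurableSet_forall_dist_lt {X E : Type*} [MeasurableSpace X]
    [PseudoMetricSpace E] {μ : Measure X} {f : X → E} {s : Set X} (hs : MeasurableSet s)
    (hμ : μ s ≠ 0) (hf : AEStronglyMeasurable f (μ.restrict s)) {ε : ℝ} (hε : 0 < ε) :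
    ∃ t ⊆ s, MeasurableSet t ∧ 0 < μ t ∧ ∀ a ∈ t, ∀ b ∈ t, dist (f a) (f b) < ε := by
  borelize E
  obtain ⟨f', hf', hff'⟩ := hf
  obtain ⟨c, hc, hcr⟩ := hf'.isSeparable_range
  have hcover : (Set.univ : Set X) ⊆ ⋃ y ∈ c, f' ⁻¹' Metric.ball y (ε / 2) := by
    intro x _
    obtain ⟨y, hy, hxy⟩ := Metric.mem_closure_iff.1 (hcr (Set.mem_range_self x)) (ε / 2)
      (half_pos hε)
    exact Set.mem_biUnion hy hxy
  obtain ⟨y, -, hy⟩ : ∃ y ∈ c, (μ.restrict s) (f' ⁻¹' Metric.ball y (ε / 2)) ≠ 0 := by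
    by_contra! h
    refine hμ ?_
    rw [← Measure.restrict_apply_univ]
    exact measure_mono_null hcover ((measure_biUnion_null_iff hc).2 h)
  obtain ⟨z, hzsub, hz, hz0⟩ := exists_measurable_superset_of_null (ae_iff.1 hff')
  have hm : MeasurableSet (f' ⁻¹' Metric.ball y (ε / 2) \ z) :=
    (hf'.measurable Metric.isOpen_ball.measurableSet).diff hz
  refine ⟨_, Set.inter_subset_right, hm.inter hs, ?_, ?_⟩
  · rw [← Measure.restrict_apply hm, measure_sdiff_null hz0]
    exact pos_iff_ne_zero.2 hy
  · rintro a ⟨⟨ha, haz⟩, -⟩ b ⟨⟨hb, hbz⟩, -⟩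
    have ha' : f a = f' a := by by_contra h; exact haz (hzsub h)
    have hb' : f b = f' b := by by_contra h; exact hbz (hzsub h)
    rw [ha', hb']
    have h1 : dist (f' a) y < ε / 2 := ha
    have h2 : dist (f' b) y < ε / 2 := hb
    linarith [dist_triangle_right (f' a) (f' b) y]

/-- Measurable unitary representations are strongly continuous. -/
theorem MonoidHom.continuous_apply_of_isHaarMeasurable (V : G →* unitary (H →L[ℂ] H))
    (hV : IsHaarMeasurable V) (x : H) : Continuous fun g => (V g : H →L[ℂ] H) x := by
  have hVm (a b : G) (y : H) : (V (a * b) : H →L[ℂ] H) y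
      = (V a : H →L[ℂ] H) ((V b : H →L[ℂ] H) y) := by simp
  have near (ε : ℝ) (hε : 0 < ε) : ∀ᶠ k in 𝓝 (1 : G), ‖(V k : H →L[ℂ] H) x - x‖ < ε := by
    obtain ⟨K, hK, hK1⟩ := exists_compact_mem_nhds (1 : G)
    obtain ⟨E, hEK, hE, hE0, hdist⟩ := exists_measurableSet_forall_dist_lt hK.measurableSet
      (measure_pos_of_mem_nhds haar hK1).ne' (hV x K hK) (ε := ε / 3) (by positivity)
    have hdiv : E / E ∈ 𝓝 (1 : G) := div_mem_nhds_one_of_haar_pos_ne_top haar E hE hE0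
      ((measure_mono hEK).trans_lt hK.measure_lt_top).ne
    -- Steinhaus gives control of `V k y - y` for `k` in `E / E` at the vector `y = V a x`, with
    -- `a ∈ E`; conjugating by `a` brings it to `x`.
    obtain ⟨a, ha⟩ := nonempty_of_measure_ne_zero hE0.ne'
    have hconj : Filter.Tendsto (fun k : G => a * k * a⁻¹) (𝓝 1) (𝓝 1) := by
      have : Continuous fun k : G => a * k * a⁻¹ := by fun_prop
      simpa using this.tendsto 1
    filter_upwards [hconj hdiv] with k hk
    obtain ⟨b, hb, c, hc, hbc⟩ := hk
    have hbc : b = a * k * a⁻¹ * c := div_eq_iff_eq_mul.1 hbc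
    have e1 : ‖(V k : H →L[ℂ] H) x - x‖ =
        ‖(V (a * k * a⁻¹) : H →L[ℂ] H) ((V a : H →L[ℂ] H) x) - (V a : H →L[ℂ] H) x‖ := by
      rw [← norm_unitary_apply (V a), map_sub, ← hVm, ← hVm]
      simp
    have e2 := hdist a ha c hc
    have e3 := hdist c hc a ha
    have e4 := hdist b hb c hc
    rw [dist_eq_norm] at e2 e3 e4
    rw [hbc, hVm] at e4
    rw [← norm_unitary_apply (V (a * k * a⁻¹)), map_sub] at e2
    rw [e1]
    calc _ = ‖((V (a * k * a⁻¹) : H →L[ℂ] H) ((V a : H →L[ℂ] H) x)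
            - (V (a * k * a⁻¹) : H →L[ℂ] H) ((V c : H →L[ℂ] H) x))
          + ((V (a * k * a⁻¹) : H →L[ℂ] H) ((V c : H →L[ℂ] H) x) - (V c : H →L[ℂ] H) x)
          + ((V c : H →L[ℂ] H) x - (V a : H →L[ℂ] H) x)‖ := by congr 1; abel
      _ ≤ _ := norm_add₃_le
      _ < ε := by linarith
  rw [continuous_iff_continuousAt]
  intro g
  rw [Metric.continuousAt_iff']
  intro ε hε
  have hg : Filter.Tendsto (fun k : G => g⁻¹ * k) (𝓝 g) (𝓝 1) := by
    have : Continuous fun k : G => g⁻¹ * k := by fun_prop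
    simpa using this.tendsto g
  filter_upwards [hg (near ε hε)] with k hk
  have hk : ‖(V (g⁻¹ * k) : H →L[ℂ] H) x - x‖ < ε := hk
  rwa [← norm_unitary_apply (V g), map_sub, ← hVm, mul_inv_cancel_left, ← dist_eq_norm] at hk

end Steinhaus

/-! ### Null sets of pairs in a `σ`-compact group -/

section Fubini

variable {G : Type*} [Group G] [TopologicalSpace G] [IsTopologicalGroup G]
  [LocallyCompactSpace G] [T2Space G] [MeasurableSpace G] [BorelSpace G]
  {X : Type*} [Group X] [TopologicalSpace X] [IsTopologicalGroup X]
  [MeasurableSpace X] [BorelSpace X]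

theorem MeasureTheory.Measure.ext_of_isCompact_closure {Y : Type*} [TopologicalSpace Y] [T2Space Y]
    [SigmaCompactSpace Y] [MeasurableSpace Y] [BorelSpace Y] {μ ν : Measure Y}
    (h : ∀ s, MeasurableSet s → IsCompact (closure s) → μ s = ν s) : μ = ν := by
  ext s hs
  have hmono : Monotone fun n => s ∩ compactCovering Y n := fun m n hmn =>
    Set.inter_subset_inter_right _ (compactCovering_subset Y hmn)
  have hunion : s = ⋃ n, s ∩ compactCovering Y n := by
    rw [← Set.inter_iUnion, iUnion_compactCovering, Set.inter_univ]
  rw [hunion, hmono.measure_iUnion, hmono.measure_iUnion]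
  refine iSup_congr fun n => h _ (hs.inter (isCompact_compactCovering Y n).measurableSet) ?_
  exact (isCompact_compactCovering Y n).closure_of_subset Set.inter_subset_right

theorem exists_eq_smul_of_isMulLeftInvariant [SigmaCompactSpace G] (μ' μ : Measure G)
    [μ.IsHaarMeasure] [IsFiniteMeasureOnCompacts μ'] [μ'.IsMulLeftInvariant] :
    ∃ c : ℝ≥0∞, μ' = c • μ :=
  ⟨haarScalarFactor μ' μ, Measure.ext_of_isCompact_closure fun _ _ h's =>
    measure_isMulInvariant_eq_smul_of_isCompact_closure μ' μ h's⟩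

/-- Haar measure on a group `X` isomorphic to `G × G`, restricted to the product `σ`-algebra, is a
multiple of the product of Haar measures. The group `X` stands for `G × G` with its Borel
`σ`-algebra, which the product instance on `G × G` need not carry. -/
theorem exists_map_eq_smul_prod [SigmaCompactSpace G] (e : X ≃ₜ* G × G) (ν : Measure X)
    [ν.IsHaarMeasure] (μ : Measure G) [μ.IsHaarMeasure] :
    ∃ c : ℝ≥0∞, c ≠ 0 ∧ ν.map e = c • μ.prod μ := by
  have he : Measurable e :=
    (continuous_fst.comp (map_continuous e)).measurable.prodMk
      (continuous_snd.comp (map_continuous e)).measurable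
  have inv (p : G × G) {s : Set (G × G)} (hs : MeasurableSet s) :
      ν.map e ((fun q => p * q) ⁻¹' s) = ν.map e s := by
    have hp : Measurable fun q : G × G => p * q :=
      (measurable_fst.const_mul p.1).prodMk (measurable_snd.const_mul p.2)
    rw [Measure.map_apply he (hp hs), Measure.map_apply he hs,
      ← measure_preimage_mul ν (e.symm p) (e ⁻¹' s)]
    congr 1
    ext x
    simp
  have fin {s t : Set G} (hs : IsCompact (closure s)) (ht : IsCompact (closure t))
      (hsm : MeasurableSet s) (htm : MeasurableSet t) : ν.map e (s ×ˢ t) < ∞ := by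
    rw [Measure.map_apply he (hsm.prod htm)]
    refine (measure_mono (Set.preimage_mono (Set.prod_mono subset_closure subset_closure))).trans_lt
      (IsCompact.measure_lt_top ?_)
    exact e.toHomeomorph.isCompact_preimage.2 (hs.prod ht)
  have slice₁ {t : Set G} (ht : IsCompact (closure t)) (htm : MeasurableSet t) :
      ∃ c : ℝ≥0∞, ∀ s, MeasurableSet s → ν.map e (s ×ˢ t) = c * μ s := by
    let ρ : Measure G := ((ν.map e).restrict (Set.univ ×ˢ t)).map Prod.fst
    have hρ (s : Set G) (hs : MeasurableSet s) : ρ s = ν.map e (s ×ˢ t) := by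
      rw [Measure.map_apply measurable_fst hs, Measure.restrict_apply (measurable_fst hs)]
      congr 1; ext; simp
    have : ρ.IsMulLeftInvariant := by
      rw [← forall_measure_preimage_mul_iff]
      intro g s hs
      rw [hρ _ hs, hρ _ (measurable_const_mul g hs), ← inv (g, 1) (hs.prod htm)]
      congr 1; ext; simp
    have : IsFiniteMeasureOnCompacts ρ := ⟨fun K hK => by
      rw [hρ _ hK.measurableSet]
      exact fin (by rwa [hK.isClosed.closure_eq]) ht hK.measurableSet htm⟩
    obtain ⟨c, hc⟩ := exists_eq_smul_of_isMulLeftInvariant ρ μ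
    refine ⟨c, fun s hs => ?_⟩
    rw [← hρ s hs, hc]; rfl
  have row {s : Set G} (hsm : MeasurableSet s) :
      ∃ ρ : Measure G, ∀ t, MeasurableSet t → ρ t = ν.map e (s ×ˢ t) := by
    refine ⟨((ν.map e).restrict (s ×ˢ Set.univ)).map Prod.snd, fun t ht => ?_⟩
    rw [Measure.map_apply measurable_snd ht, Measure.restrict_apply (measurable_snd ht)]
    congr 1; ext; simp [and_comm]
  have slice₂ {s : Set G} (hs : IsCompact (closure s)) (hsm : MeasurableSet s) :
      ∃ c : ℝ≥0∞, ∀ t, MeasurableSet t → ν.map e (s ×ˢ t) = c * μ t := by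
    obtain ⟨ρ, hρ⟩ := row hsm
    have : ρ.IsMulLeftInvariant := by
      rw [← forall_measure_preimage_mul_iff]
      intro g t ht
      rw [hρ _ ht, hρ _ (measurable_const_mul g ht), ← inv (1, g) (hsm.prod ht)]
      congr 1; ext; simp
    have : IsFiniteMeasureOnCompacts ρ := ⟨fun K hK => by
      rw [hρ _ hK.measurableSet]
      exact fin hs (by rwa [hK.isClosed.closure_eq]) hsm hK.measurableSet⟩
    obtain ⟨c, hc⟩ := exists_eq_smul_of_isMulLeftInvariant ρ μ
    refine ⟨c, fun t ht => ?_⟩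
    rw [← hρ t ht, hc]; rfl
  -- Comparing the two descriptions of the measure of `K ×ˢ t` makes the factor of `slice₁`
  -- proportional to `μ t`.
  obtain ⟨K, hK, hK1⟩ := exists_compact_mem_nhds (1 : G)
  have hKc : IsCompact (closure K) := by rwa [hK.isClosed.closure_eq]
  have hK0 : μ K ≠ 0 := (measure_pos_of_mem_nhds μ hK1).ne'
  have hKtop : μ K ≠ ∞ := hK.measure_lt_top.ne
  obtain ⟨d, hd⟩ := slice₂ hKc hK.measurableSet
  have hd0 : d ≠ 0 := by
    rintro rfl
    have h := hd K hK.measurableSet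
    rw [zero_mul, Measure.map_apply he (hK.measurableSet.prod hK.measurableSet)] at h
    refine (measure_pos_of_mem_nhds ν (x := e.symm 1) ?_).ne' h
    refine (map_continuous e).continuousAt.preimage_mem_nhds ?_
    rw [e.apply_symm_apply]
    exact prod_mem_nhds hK1 hK1
  have rect₁ (s t : Set G) (hs : MeasurableSet s) (ht : MeasurableSet t)
      (htc : IsCompact (closure t)) : ν.map e (s ×ˢ t) = μ s * (d / μ K * μ t) := by
    obtain ⟨c, hc⟩ := slice₁ htc ht
    have h1 : c * μ K = d * μ t := (hc K hK.measurableSet).symm.trans (hd t ht)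
    have h2 : c = d / μ K * μ t := by
      rw [← ENNReal.mul_div_cancel_right (a := c) hK0 hKtop, h1]
      simp only [div_eq_mul_inv]; ring
    rw [hc s hs, h2, mul_comm]
  have rect (s t : Set G) (hs : MeasurableSet s) (ht : MeasurableSet t) :
      ν.map e (s ×ˢ t) = μ s * (d / μ K * μ t) := by
    obtain ⟨ρ, hρ⟩ := row hs
    have : ρ = (μ s * (d / μ K)) • μ := Measure.ext_of_isCompact_closure fun t ht htc => by
      rw [hρ t ht, rect₁ s t hs ht htc, Measure.smul_apply, smul_eq_mul, mul_assoc]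
    rw [← hρ t ht, this, Measure.smul_apply, smul_eq_mul, mul_assoc]
  have hcne : d / μ K ≠ 0 := ENNReal.div_ne_zero.2 ⟨hd0, hKtop⟩
  have hctop : d / μ K ≠ ∞ := by
    refine ENNReal.div_ne_top ?_ hK0
    rintro rfl
    have h := fin hKc hKc hK.measurableSet hK.measurableSet
    rw [hd K hK.measurableSet, ENNReal.top_mul hK0] at h
    exact h.ne rfl
  refine ⟨d / μ K, hcne, ?_⟩
  lift d / μ K to NNReal using hctop with c
  refine (Measure.prod_eq (ν := c • μ) fun s t hs ht => rect s t hs ht).symm.trans ?_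
  exact Measure.prod_smul_right (c : ℝ≥0∞)

/-- A Chebyshev inequality for the sections of an open set `W`, which need not belong to the product
`σ`-algebra: `m` only has to bound the measures of the product-measurable subsets of `W`. -/
theorem mul_measure_setOf_lt_measure_le {Y : Type*} [TopologicalSpace Y] [T2Space Y]
    [MeasurableSpace Y] [BorelSpace Y] {μ : Measure Y} [μ.Regular] [SFinite μ]
    {W : Set (Y × Y)} (hW : IsOpen W) {m c ε : ℝ≥0∞}
    (hm : ∀ P ⊆ W, MeasurableSet P → c * μ.prod μ P ≤ m) :
    c * (ε * μ {h | ε < μ (Prod.mk h ⁻¹' W)}) ≤ m := by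
  have hsec (h : Y) : IsOpen (Prod.mk h ⁻¹' W) := hW.preimage (Continuous.prodMk_right h)
  -- A compact subset of a section is, by the tube lemma, contained in all nearby sections.
  have tube (h : Y) (hh : ε < μ (Prod.mk h ⁻¹' W)) : ∃ V, IsOpen V ∧ h ∈ V ∧
      ∃ K, IsCompact K ∧ ε < μ K ∧ V ×ˢ K ⊆ W := by
    obtain ⟨K, hKW, hK, hεK⟩ := (hsec h).exists_lt_isCompact hh
    obtain ⟨V, K', hV, -, hhV, hKK', hVK⟩ := generalized_tube_lemma (isCompact_singleton (x := h))
      hK hW (by rintro ⟨a, b⟩ ⟨rfl, hb⟩; exact hKW hb)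
    exact ⟨V, hV, hhV rfl, K, hK, hεK, (Set.prod_mono_right hKK').trans hVK⟩
  have hopen : IsOpen {h | ε < μ (Prod.mk h ⁻¹' W)} := by
    refine isOpen_iff_mem_nhds.2 fun h hh => ?_
    obtain ⟨V, hV, hhV, K, -, hεK, hVK⟩ := tube h hh
    filter_upwards [hV.mem_nhds hhV] with a ha
    exact hεK.trans_le (measure_mono fun b hb => hVK ⟨ha, hb⟩)
  rw [hopen.measure_eq_iSup_isCompact]
  simp only [ENNReal.mul_iSup]
  refine iSup₂_le fun L hL => iSup_le fun hLc => ?_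
  obtain ⟨P, hP, hPW, hLP⟩ : ∃ P, MeasurableSet P ∧ P ⊆ W ∧ ∀ h ∈ L, ε ≤ μ (Prod.mk h ⁻¹' P) := by
    refine hLc.induction_on (p := fun L => ∃ P, MeasurableSet P ∧ P ⊆ W ∧
      ∀ h ∈ L, ε ≤ μ (Prod.mk h ⁻¹' P)) ⟨∅, by simp⟩ ?_ ?_ ?_
    · rintro s t hst ⟨P, hP, hPW, h⟩
      exact ⟨P, hP, hPW, fun a ha => h a (hst ha)⟩
    · rintro s t ⟨P, hP, hPW, h⟩ ⟨Q, hQ, hQW, h'⟩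
      refine ⟨P ∪ Q, hP.union hQ, Set.union_subset hPW hQW, ?_⟩
      rintro a (ha | ha)
      · exact (h a ha).trans (measure_mono (Set.preimage_mono Set.subset_union_left))
      · exact (h' a ha).trans (measure_mono (Set.preimage_mono Set.subset_union_right))
    · intro h hh
      obtain ⟨V, hV, hhV, K, hK, hεK, hVK⟩ := tube h (hL hh)
      refine ⟨V, mem_nhdsWithin_of_mem_nhds (hV.mem_nhds hhV), V ×ˢ K,
        hV.measurableSet.prod hK.measurableSet, hVK, fun a ha => ?_⟩
      exact hεK.le.trans (measure_mono fun b hb => ⟨ha, hb⟩)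
  refine le_trans ?_ (hm P hPW hP)
  gcongr
  rw [Measure.prod_apply hP, ← setLIntegral_const]
  exact (setLIntegral_mono' hLc.measurableSet hLP).trans (setLIntegral_le_lintegral _ _)

/-- The half of Fubini's theorem for null sets that survives on the full Borel `σ`-algebra of the
product: almost all sections of a null set are null. -/
theorem ae_ae_notMem_of_measure_eq_zero [SigmaCompactSpace G] (e : X ≃ₜ* G × G) {ν : Measure X}
    [ν.IsHaarMeasure] [ν.OuterRegular] (μ : Measure G) [μ.IsHaarMeasure] [μ.Regular] {N : Set X}
    (hN : ν N = 0) : ∀ᵐ h ∂μ, ∀ᵐ g ∂μ, e.symm (h, g) ∉ N := by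
  obtain ⟨c, hc, hcν⟩ := exists_map_eq_smul_prod e ν μ
  have he : Measurable e :=
    (continuous_fst.comp (map_continuous e)).measurable.prodMk
      (continuous_snd.comp (map_continuous e)).measurable
  have null (ε : ℝ≥0∞) (hε : ε ≠ 0) : μ {h | ε < μ {g | e.symm (h, g) ∈ N}} = 0 := by
    suffices h : c * (ε * μ {h | ε < μ {g | e.symm (h, g) ∈ N}}) = 0 by
      simpa [hc, hε] using h
    refine le_antisymm (le_of_forall_gt fun δ hδ => ?_) zero_le
    obtain ⟨W, hNW, hW, hWδ⟩ := N.exists_isOpen_lt_of_lt (μ := ν) δ (by rwa [hN])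
    refine lt_of_le_of_lt ?_ hWδ
    have hW' : IsOpen (e.symm ⁻¹' W) := hW.preimage (map_continuous e.symm)
    refine le_trans ?_ (mul_measure_setOf_lt_measure_le hW' (μ := μ) (c := c) (ε := ε)
      fun P hPW hP => ?_)
    · gcongr with h
      exact fun g hg => hNW hg
    · rw [← smul_eq_mul, ← Measure.smul_apply, ← hcν, Measure.map_apply he hP]
      refine measure_mono fun x hx => ?_
      simpa using hPW hx
  obtain ⟨u, -, hu0, hu⟩ := exists_seq_strictAnti_tendsto' (zero_lt_one (α := ℝ≥0∞))
  have hall : ∀ᵐ h ∂μ, ∀ n, ¬ u n < μ {g | e.symm (h, g) ∈ N} := by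
    refine ae_all_iff.2 fun n => ae_iff.2 ?_
    simpa using null (u n) (hu0 n).1.ne'
  filter_upwards [hall] with h hh
  rw [ae_iff]
  simp only [not_not]
  exact le_antisymm (ge_of_tendsto' hu fun n => not_lt.1 (hh n)) zero_le

end Fubini

/-! ### Null sets of pairs in a group that is not `σ`-compact -/

section NotSigmaCompact

theorem exists_isOpen_isSigmaCompact_subgroup (G : Type*) [Group G] [TopologicalSpace G]
    [IsTopologicalGroup G] [LocallyCompactSpace G] :
    ∃ S : Subgroup G, IsOpen (S : Set G) ∧ IsSigmaCompact (S : Set G) := by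
  obtain ⟨L, hL, hL1⟩ := exists_compact_mem_nhds (1 : G)
  have hK : IsCompact (L ∪ L⁻¹) := hL.union hL.inv
  have hKinv : (L ∪ L⁻¹)⁻¹ = L ∪ L⁻¹ := by rw [Set.union_inv, inv_inv, Set.union_comm]
  have hpow (n : ℕ) : IsCompact ((L ∪ L⁻¹) ^ n) := by
    induction n with
    | zero => simp
    | succ n ih => rw [pow_succ]; exact ih.mul hK
  let S : Subgroup G :=
    { carrier := ⋃ n : ℕ, (L ∪ L⁻¹) ^ n
      one_mem' := Set.mem_iUnion.2 ⟨0, by simp⟩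
      mul_mem' := by
        intro a b ha hb
        obtain ⟨m, hm⟩ := Set.mem_iUnion.1 ha
        obtain ⟨n, hn⟩ := Set.mem_iUnion.1 hb
        exact Set.mem_iUnion.2 ⟨m + n, by rw [pow_add]; exact Set.mul_mem_mul hm hn⟩
      inv_mem' := by
        intro a ha
        obtain ⟨m, hm⟩ := Set.mem_iUnion.1 ha
        refine Set.mem_iUnion.2 ⟨m, ?_⟩
        rw [← hKinv, inv_pow]
        exact Set.inv_mem_inv.2 hm }
  refine ⟨S, S.isOpen_of_mem_nhds (g := 1) ?_, isSigmaCompact_iUnion_of_isCompact _ hpow⟩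
  filter_upwards [hL1] with g hg
  exact Set.mem_iUnion.2 ⟨1, by rw [pow_one]; exact Or.inl hg⟩

variable {G : Type*} [Group G] [TopologicalSpace G] [IsTopologicalGroup G]
  [LocallyCompactSpace G]

/-- A set of finite measure lies in an open set of finite measure, and this meets the preimages of
only countably many cosets of an open `σ`-compact subgroup, as each of these intersections that is
nonempty has positive measure. -/
theorem exists_isSigmaCompact_forall_apply_mem {X : Type*} [TopologicalSpace X]
    [MeasurableSpace X] [BorelSpace X] {ν : Measure X} [ν.OuterRegular] [ν.IsOpenPosMeasure]
    {f : X → G} (hf : Continuous f) {N : Set X} (hN : ν N ≠ ∞) :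
    ∃ D : Set G, IsSigmaCompact D ∧ ∀ p ∈ N, f p ∈ D := by
  obtain ⟨S, hSo, hSc⟩ := exists_isOpen_isSigmaCompact_subgroup G
  have : DiscreteTopology (G ⧸ S) := QuotientGroup.discreteTopology hSo
  obtain ⟨W, hNW, hW, hWtop⟩ := N.exists_isOpen_lt_of_lt (μ := ν) ∞ hN.lt_top
  let q : X → G ⧸ S := fun p => (f p : G ⧸ S)
  have hq : Continuous q := QuotientGroup.continuous_mk.comp hf
  have hA (i : G ⧸ S) : IsOpen (W ∩ q ⁻¹' {i}) := hW.inter ((isOpen_discrete {i}).preimage hq)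
  have hcount : {i | 0 < ν (W ∩ q ⁻¹' {i})}.Countable :=
    countable_meas_pos_of_disjoint_of_meas_iUnion_ne_top ν (fun i => (hA i).measurableSet)
      (fun i j hij => ((Set.disjoint_singleton.2 hij).preimage q).mono Set.inter_subset_right
        Set.inter_subset_right)
      (ne_top_of_le_ne_top hWtop.ne (measure_mono (Set.iUnion_subset fun _ => Set.inter_subset_left)))
  refine ⟨⋃ i ∈ {i | 0 < ν (W ∩ q ⁻¹' {i})}, (QuotientGroup.mk : G → G ⧸ S) ⁻¹' {i}, ?_, ?_⟩
  · refine isSigmaCompact_biUnion hcount fun i _ => ?_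
    obtain ⟨g, rfl⟩ := QuotientGroup.mk_surjective i
    have : (QuotientGroup.mk : G → G ⧸ S) ⁻¹' {(g : G ⧸ S)} = (fun x => g * x) '' (S : Set G) := by
      ext x
      simp only [Set.mem_preimage, Set.mem_singleton_iff, Set.image_mul_left, SetLike.mem_coe]
      rw [eq_comm, QuotientGroup.eq]
    rw [this]
    exact hSc.image (continuous_const_mul g)
  · intro p hp
    exact Set.mem_biUnion (x := q p) ((hA (q p)).measure_pos ν ⟨p, hNW hp, rfl⟩) rfl

theorem forall_mul_eq_of_forall_notMem_isSigmaCompact {G R : Type*} [Group G] [TopologicalSpace G]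
    [IsTopologicalGroup G] [Group R]
    (hG : ¬ SigmaCompactSpace G) {D : Set G} (hD : IsSigmaCompact D) {U : G → R}
    (hU : ∀ g ∉ D, ∀ h, U g * U h = U (g * h)) (h k : G) : U h * U k = U (h * k) := by
  have hDh : IsSigmaCompact ((fun g => g * h⁻¹) '' D) := hD.image (continuous_mul_const _)
  -- Outside `D` and `D * h⁻¹` both `g` and `g * h` multiply exactly, so that `U (g * h * k)` can be
  -- expanded in two ways.
  obtain ⟨g, hg⟩ : ∃ g, g ∉ D ∪ (fun g => g * h⁻¹) '' D := by
    by_contra! hall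
    have hcov : D ∪ (fun g => g * h⁻¹) '' D = Set.univ := Set.eq_univ_of_forall hall
    refine hG (isSigmaCompact_univ_iff.1 ?_)
    rw [← hcov, Set.union_eq_iUnion]
    exact isSigmaCompact_iUnion _ (by rintro (_ | _) <;> assumption)
  have hg1 : g ∉ D := fun h' => hg (Or.inl h')
  have hg2 : g * h ∉ D := fun h' => hg (Or.inr ⟨_, h', mul_inv_cancel_right g h⟩)
  refine mul_left_cancel (a := U g) ?_
  rw [← mul_assoc, hU g hg1, hU _ hg2, hU g hg1, mul_assoc]

end NotSigmaCompact

/-! ### Correcting a measurable weak representation on a null set -/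

theorem mainTheorem3 {G : Type*} [Group G] [TopologicalSpace G] [IsTopologicalGroup G]
    [LocallyCompactSpace G] [T2Space G] [MeasurableSpace G] [BorelSpace G]
    {H : Type*} [NormedAddCommGroup H] [InnerProductSpace ℂ H] [CompleteSpace H]
    (U : G → unitary (H →L[ℂ] H)) (hU : IsMeasurableWeakRep U) :
    ∃ V : G →* unitary (H →L[ℂ] H),
      (∀ x : H, Continuous fun g => (V g : H →L[ℂ] H) x) ∧
      ∀ᵐ g ∂(haar : Measure G), U g = V g := by
  suffices h : ∃ V : G →* unitary (H →L[ℂ] H), ∀ᵐ g ∂(haar : Measure G), U g = V g by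
    obtain ⟨V, hV⟩ := h
    refine ⟨V, MonoidHom.continuous_apply_of_isHaarMeasurable V fun x K hK => ?_, hV⟩
    refine (hU.measurable x K hK).congr (ae_restrict_of_ae ?_)
    filter_upwards [hV] with g hg
    rw [hg]
  have hN : haarPairs G {p | ¬ U p.1 * U p.2 = U (p.1 * p.2)} = 0 := ae_iff.1 hU.mul_ae
  -- From here on `G × G` carries its Borel `σ`-algebra.
  let _ : MeasurableSpace (G × G) := borel (G × G)
  have : BorelSpace (G × G) := ⟨rfl⟩
  change (haar : Measure (G × G)) _ = 0 at hN
  by_cases hG : SigmaCompactSpace G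
  · refine exists_monoidHom_ae_eq (μ := haar) ?_
    have h := ae_ae_notMem_of_measure_eq_zero (ContinuousMulEquiv.refl (G × G)) haar hN
    exact h.mono fun a ha => ha.mono fun g hg => not_not.1 hg
  · obtain ⟨D, hD, hND⟩ := exists_isSigmaCompact_forall_apply_mem
      (ν := (haar : Measure (G × G))) continuous_fst (hN.trans_ne ENNReal.zero_ne_top)
    refine ⟨MonoidHom.mk' U fun a b => (forall_mul_eq_of_forall_notMem_isSigmaCompact hG hD
      (fun g hg h => ?_) a b).symm, Filter.Eventually.of_forall fun g => rfl⟩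
    by_contra hgh
    exact hg (hND (g, h) hgh)
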